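/- Let $V$ be Thompson's group, i.e. the group of all permutations $g$ of the set $\{a,b\}^{\omega}$ of infinite words for which there are finite maximal prefix codes $P,Q\subset\{a,b\}^*$ and a bijection $\tau:P\to Q$ with $g(py)=\tau(p)y$ for all $p\in P$ and $y\in\{a,b\}^{\omega}$. For a subset $S$ of a group and an element $g$ of the subgroup $\langle S\rangle$, let $|g|_S$ be the minimal length of a word over $S\cup S^{-1}$ representing $g$. If $A$ is a finite generating set of a group and $X$ is a finite subset of that group, a *distortion function* of $\langle X\rangle$ (with respect to $A$ and $X$) is any non-decreasing function $f:\mathbb{N}\to\mathbb{N}$ such that $|g|_X\le f(|g|_A)$ for all $g\in\langle X\rangle$ (the function $f$ is not required to be the smallest one). Two functions $f_1,f_2:\mathbb{N}\to\mathbb{N}$ are *linearly equivalent* if there are positive integers $c_0,C_{12},c_{12},C_{21},c_{21}$ such that $f_1(n)\le C_{12}f_2(c_{12}n)$ and $f_2(n)\le C_{21}f_1(c_{21}n)$ for all $n\ge c_0$. **Proposition.** Let $G$ be a finitely generated subgroup of $V$, and let $\delta$ be a distortion function of $G$ in $V$ (with respect to some finite generating set $A$ of $V$ and some finite generating set $X$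 of $G$). Then $V$ contains a finitely generated subgroup $K\cong G\times G$ such that, for every finite generating set $B$ of $V$ and every finite generating set $Y$ of $K$, the subgroup $K$ has a distortion function (with respect to $B$ and $Y$) that is linearly equivalent to $n\mapsto\delta(\lceil n\log_2 n\rceil)$ (where $n\log_2 n$ is read as $0$ for $n=0$). -/

import Mathlib

/-- A prefix code over the alphabet `{a, b}` (modelled by `Bool`): a set of finite words none of
which is a strict prefix of another one. -/
def IsPrefixCode (C : Set (List Bool)) : Prop :=
  ∀ u ∈ C, ∀ v ∈ C, u <+: v → u = v

/-- A maximal prefix code: a prefix code that is not a strict subset of another prefix code. -/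
def IsMaximalPrefixCode (C : Set (List Bool)) : Prop :=
  IsPrefixCode C ∧ ∀ D : Set (List Bool), IsPrefixCode D → C ⊆ D → D = C

/-- A permutation `g` of the set of infinite words over `{a, b}` is given by a finite table: there
are finite maximal prefix codes `P`, `Q` and a bijection `τ : P → Q` such that `g (p y) = τ(p) y`
for every `p ∈ P` and every infinite word `y`. -/
def HasFiniteTable (g : Equiv.Perm (Stream' Bool)) : Prop :=
  ∃ P Q : Set (List Bool), P.Finite ∧ Q.Finite ∧ IsMaximalPrefixCode P ∧ IsMaximalPrefixCode Q ∧
    ∃ τ : List Bool → List Bool, Set.BijOn τ P Q ∧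
      ∀ p ∈ P, ∀ y : Stream' Bool, g (Stream'.appendStream' p y) = Stream'.appendStream' (τ p) y

theorem prefix_or_prefix_of_append_eq {u v : List Bool} {x y : Stream' Bool}
    (h : Stream'.appendStream' u x = Stream'.appendStream' v y) : u <+: v ∨ v <+: u := by
  rcases le_total u.length v.length with hl | hl
  · left
    have h1 := congrArg (Stream'.take u.length) h
    rw [Stream'.take_append_of_le_length (h := le_rfl),
      Stream'.take_append_of_le_length (h := hl), List.take_length] at h1
    rw [h1]
    exact List.take_prefix _ _
  · right
    have h1 := congrArg (Stream'.take v.length) h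
    rw [Stream'.take_append_of_le_length (h := le_rfl),
      Stream'.take_append_of_le_length (h := hl), List.take_length] at h1
    rw [← h1]
    exact List.take_prefix _ _

theorem isMaximalPrefixCode_of_covers {C : Set (List Bool)} (hC : IsPrefixCode C)
    (hcov : ∀ x : Stream' Bool, ∃ c ∈ C, ∃ y, x = Stream'.appendStream' c y) :
    IsMaximalPrefixCode C := by
  refine ⟨hC, fun D hD hCD => Set.Subset.antisymm (fun d hd => ?_) hCD⟩
  obtain ⟨c, hc, y, hy⟩ := hcov (Stream'.appendStream' d (Stream'.const true))
  rcases prefix_or_prefix_of_append_eq hy with h | h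
  · rw [hD d hd c (hCD hc) h]
    exact hc
  · rw [← hD c (hCD hc) d hd h]
    exact hc

theorem IsMaximalPrefixCode.exists_prefix {C : Set (List Bool)} (hC : IsMaximalPrefixCode C)
    {w : List Bool} (hw : ∀ c ∈ C, c.length ≤ w.length) : ∃ c ∈ C, c <+: w := by
  by_contra! hno
  have hD : IsPrefixCode (insert w C) := by
    intro u hu v hv huv
    rcases hu with rfl | hu <;> rcases hv with rfl | hv
    · rfl
    · exact huv.eq_of_length (le_antisymm huv.length_le (hw v hv))
    · exact absurd huv (hno u hu)
    · exact hC.1 u hu v hv huv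
  have hwC : w ∈ C := by
    rw [← hC.2 _ hD (Set.subset_insert w C)]
    exact Set.mem_insert w C
  exact hno w hwC (List.prefix_refl w)

theorem hasFiniteTable_iff (g : Equiv.Perm (Stream' Bool)) :
    HasFiniteTable g ↔ ∃ N : ℕ, ∀ w : List Bool, N ≤ w.length →
      ∃ v : List Bool, ∀ y : Stream' Bool, g (Stream'.appendStream' w y) = Stream'.appendStream' v y := by
  constructor
  · rintro ⟨P, Q, hP, -, hPm, -, τ, -, hg⟩
    obtain ⟨N, hN⟩ := (hP.image List.length).bddAbove
    refine ⟨N, fun w hw => ?_⟩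
    obtain ⟨p, hp, z, rfl⟩ := hPm.exists_prefix (w := w)
      (fun c hc => (hN (Set.mem_image_of_mem _ hc)).trans hw)
    refine ⟨τ p ++ z, fun y => ?_⟩
    rw [Stream'.append_append_stream, Stream'.append_append_stream, hg p hp]
  · rintro ⟨N, hN⟩
    choose! τ hτ using hN
    have hPfin : {w : List Bool | w.length = N}.Finite := List.finite_length_eq Bool N
    have key : ∀ w : List Bool, w.length = N → ∀ w' : List Bool, w'.length = N →
        τ w <+: τ w' → w = w' := by
      rintro w hw w' hw' ⟨z, hz⟩
      have h1 : g (Stream'.appendStream' w (Stream'.appendStream' z (Stream'.const true))) =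
          g (Stream'.appendStream' w' (Stream'.const true)) := by
        rw [hτ w hw.ge, hτ w' hw'.ge, ← hz, Stream'.append_append_stream]
      exact Stream'.append_left_injective _ _ _ _ (g.injective h1) (hw.trans hw'.symm)
    refine ⟨{w | w.length = N}, τ '' {w | w.length = N}, hPfin, hPfin.image _, ?_, ?_, τ,
      ⟨Set.mapsTo_image _ _, ?_, Set.surjOn_image _ _⟩, fun p hp => hτ p (le_of_eq hp.symm)⟩
    · refine isMaximalPrefixCode_of_covers
        (fun u hu v hv h => h.eq_of_length (Eq.trans hu (Eq.symm hv))) fun x => ?_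
      exact ⟨x.take N, Stream'.length_take N x, x.drop N, (Stream'.append_take_drop N x).symm⟩
    · refine isMaximalPrefixCode_of_covers ?_ fun x => ?_
      · rintro _ ⟨w, hw, rfl⟩ _ ⟨w', hw', rfl⟩ h
        rw [key w hw w' hw' h]
      · have hlen := Stream'.length_take N (g.symm x)
        refine ⟨_, ⟨(g.symm x).take N, hlen, rfl⟩, (g.symm x).drop N, ?_⟩
        rw [← hτ _ hlen.ge, Stream'.append_take_drop, Equiv.apply_symm_apply]
    · intro w hw w' hw' h
      exact key w hw w' hw' (by rw [h])

/-- Thompson's group `V`: the permutations of the set of infinite words over `{a, b}` that are given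
by a bijection between two finite maximal prefix codes. -/
def thompsonV : Subgroup (Equiv.Perm (Stream' Bool)) where
  carrier := {g | HasFiniteTable g}
  one_mem' := by
    rw [Set.mem_ofPred_eq, hasFiniteTable_iff]
    exact ⟨0, fun w _ => ⟨w, fun y => rfl⟩⟩
  mul_mem' := by
    intro g h hg hh
    rw [Set.mem_ofPred_eq, hasFiniteTable_iff] at hg hh ⊢
    obtain ⟨N, hN⟩ := hg
    obtain ⟨M, hM⟩ := hh
    refine ⟨M + N, fun w hw => ?_⟩
    obtain ⟨v, hv⟩ := hM (w.take M) (by rw [List.length_take]; omega)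
    obtain ⟨u, hu⟩ := hN (v ++ w.drop M) (by rw [List.length_append, List.length_drop]; omega)
    refine ⟨u, fun y => ?_⟩
    rw [Equiv.Perm.mul_apply, ← hu y, Stream'.append_append_stream, ← hv,
      ← Stream'.append_append_stream, List.take_append_drop]
  inv_mem' := by
    rintro g ⟨P, Q, hP, hQ, hPm, hQm, τ, hτ, hg⟩
    have hinv := hτ.invOn_invFunOn
    refine ⟨Q, P, hQ, hP, hQm, hPm, Function.invFunOn τ P, hτ.symm hinv.symm, fun q hq y => ?_⟩
    have hmem : Function.invFunOn τ P q ∈ P := (hτ.symm hinv.symm).mapsTo hq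
    rw [Equiv.Perm.inv_eq_iff_eq, hg _ hmem, hinv.2 hq]

/-- The length of `g` over `S ∪ S⁻¹`: the minimal length of a word in elements of `S` and inverses
of elements of `S` that represents `g` (used only for `g` in the subgroup generated by `S`). -/
noncomputable def wordLength {G : Type*} [Group G] (S : Set G) (g : G) : ℕ :=
  sInf {n : ℕ | ∃ l : List G, l.length = n ∧ (∀ x ∈ l, x ∈ S ∨ x⁻¹ ∈ S) ∧ l.prod = g}

/-- `f` is a distortion function of the subgroup generated by `X` in the group `G` with generating
set `A`: it is non-decreasing and bounds the `X`-length of every element of the subgroup in terms of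
the `A`-length of that element. -/
def IsDistortionFunction {G : Type*} [Group G] (A X : Set G) (f : ℕ → ℕ) : Prop :=
  Monotone f ∧ ∀ g ∈ Subgroup.closure X, wordLength X g ≤ f (wordLength A g)

/-- Linear equivalence of functions: `f₁(n) = O(f₂(O(n)))` and `f₂(n) = O(f₁(O(n)))`. -/
def LinearlyEquivalent (f₁ f₂ : ℕ → ℕ) : Prop :=
  ∃ c₀ C₁₂ c₁₂ C₂₁ c₂₁ : ℕ, 0 < c₀ ∧ 0 < C₁₂ ∧ 0 < c₁₂ ∧ 0 < C₂₁ ∧ 0 < c₂₁ ∧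
    ∀ n ≥ c₀, f₁ n ≤ C₁₂ * f₂ (c₁₂ * n) ∧ f₂ n ≤ C₂₁ * f₁ (c₂₁ * n)

/-!
Let `‖g‖` be the minimal number of inner nodes of a binary tree that describes `g`, a leaf at the
address `p` being labelled by the word `τ p`. It is subadditive, so `‖g‖ = O(|g|)` for the word
length with respect to a finite generating set. Conversely `|g| = O(‖g‖ log ‖g‖)`. Indeed, swaps and
rotations next to the root of a tree are multiplications by a fixed finite set of elements of `V`,
and they suffice to move subtrees between three registers near the root. Using the registers as
stacks, the leaves of a tree are listed in linearly many such steps, and the list is sorted by a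
radix sort, with one stable partition for each of its `O(log ‖g‖)` digits. This leads from the tree
of `g` to a tree of the identity with the same leaves.

For `K` take `G × G`, acting on the words beginning with `a` and on those beginning with `b`. The
components `g`, `h` of an element of `V × V` have `‖g‖, ‖h‖ ≤ ‖(g, h)‖ + 1`, hence their length is
`O(n log n)` in terms of the length `n` of `(g, h)`, and `δ` bounds their `X`-lengths.
-/

section WordLength

variable {G H K : Type*} [Group G] [Group H] [Group K] {S : Set G}

theorem exists_list_of_mem_closure {g : G} (hg : g ∈ Subgroup.closure S) :
    ∃ l : List G, (∀ x ∈ l, x ∈ S ∨ x⁻¹ ∈ S) ∧ l.prod = g := by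
  rw [← Subgroup.mem_toSubmonoid, Subgroup.closure_toSubmonoid] at hg
  exact Submonoid.exists_list_of_mem_closure hg

theorem exists_list_length_eq_wordLength {g : G} (hg : g ∈ Subgroup.closure S) :
    ∃ l : List G, l.length = wordLength S g ∧ (∀ x ∈ l, x ∈ S ∨ x⁻¹ ∈ S) ∧ l.prod = g := by
  obtain ⟨l, hl⟩ := exists_list_of_mem_closure hg
  exact Nat.sInf_mem (s := {n | ∃ l : List G, l.length = n ∧ _}) ⟨l.length, l, rfl, hl⟩

theorem wordLength_prod_le {l : List G} (hl : ∀ x ∈ l, x ∈ S ∨ x⁻¹ ∈ S) :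
    wordLength S l.prod ≤ l.length :=
  Nat.sInf_le ⟨l, rfl, hl, rfl⟩

theorem wordLength_one : wordLength S (1 : G) = 0 :=
  Nat.le_zero.1 (wordLength_prod_le (l := []) (by simp))

theorem wordLength_le_one_of_mem {g : G} (hg : g ∈ S) : wordLength S g ≤ 1 := by
  simpa using wordLength_prod_le (l := [g]) (by simp [hg])

theorem eq_one_of_wordLength_eq_zero {g : G} (hg : g ∈ Subgroup.closure S)
    (h : wordLength S g = 0) : g = 1 := by
  obtain ⟨l, hl, -, rfl⟩ := exists_list_length_eq_wordLength hg
  rw [List.length_eq_zero_iff.1 (hl.trans h), List.prod_nil]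

theorem wordLength_mul_le {g h : G} (hg : g ∈ Subgroup.closure S) (hh : h ∈ Subgroup.closure S) :
    wordLength S (g * h) ≤ wordLength S g + wordLength S h := by
  obtain ⟨l, hl, hlS, rfl⟩ := exists_list_length_eq_wordLength hg
  obtain ⟨m, hm, hmS, rfl⟩ := exists_list_length_eq_wordLength hh
  rw [← hl, ← hm, ← List.length_append, ← List.prod_append]
  exact wordLength_prod_le fun z hz => (List.mem_append.1 hz).elim (hlS z) (hmS z)

theorem wordLength_inv_le {g : G} (hg : g ∈ Subgroup.closure S) :
    wordLength S g⁻¹ ≤ wordLength S g := by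
  obtain ⟨l, hl, hlS, rfl⟩ := exists_list_length_eq_wordLength hg
  rw [← hl, List.prod_inv_reverse]
  refine (wordLength_prod_le fun z hz => ?_).trans (by simp)
  obtain ⟨x, hx, rfl⟩ := List.mem_map.1 (List.mem_reverse.1 hz)
  simpa [or_comm] using hlS x hx

theorem le_mul_wordLength_of_subadditive {φ : G → ℕ} (map_one : φ 1 = 0)
    (map_mul_le : ∀ g ∈ Subgroup.closure S, ∀ h ∈ Subgroup.closure S, φ (g * h) ≤ φ g + φ h)
    {C : ℕ} (hC : ∀ x, x ∈ S ∨ x⁻¹ ∈ S → φ x ≤ C) {g : G} (hg : g ∈ Subgroup.closure S) :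
    φ g ≤ C * wordLength S g := by
  have mem_closure : ∀ x, x ∈ S ∨ x⁻¹ ∈ S → x ∈ Subgroup.closure S := fun x hx =>
    hx.elim (fun h => Subgroup.subset_closure h)
      fun h => (Subgroup.inv_mem_iff _).1 (Subgroup.subset_closure h)
  obtain ⟨l, hl, hlS, rfl⟩ := exists_list_length_eq_wordLength hg
  rw [← hl]
  clear hl hg
  induction l with
  | nil => simp [map_one]
  | cons x l ih =>
    rw [List.forall_mem_cons] at hlS
    rw [List.prod_cons, List.length_cons, mul_add_one, add_comm]
    exact (map_mul_le x (mem_closure x hlS.1) l.prod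
      (Subgroup.list_prod_mem _ fun y hy => mem_closure y (hlS.2 y hy))).trans
      (add_le_add (hC x hlS.1) (ih hlS.2))

theorem exists_le_mul_wordLength_of_subadditive (hS : S.Finite) {φ : G → ℕ} (map_one : φ 1 = 0)
    (map_mul_le : ∀ g ∈ Subgroup.closure S, ∀ h ∈ Subgroup.closure S, φ (g * h) ≤ φ g + φ h) :
    ∃ C, ∀ g ∈ Subgroup.closure S, φ g ≤ C * wordLength S g := by
  have hfin : {x | x ∈ S ∨ x⁻¹ ∈ S}.Finite := hS.union hS.inv
  obtain ⟨C, hC⟩ := (hfin.image φ).bddAbove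
  exact ⟨C, fun g => le_mul_wordLength_of_subadditive map_one map_mul_le
    fun x hx => hC (Set.mem_image_of_mem φ hx)⟩

theorem exists_wordLength_map_le (φ : G →* H) {X : Set G} (hX : X.Finite) {Y : Set H}
    (hY : (Subgroup.closure X).map φ ≤ Subgroup.closure Y) :
    ∃ C, ∀ g ∈ Subgroup.closure X, wordLength Y (φ g) ≤ C * wordLength X g := by
  refine exists_le_mul_wordLength_of_subadditive hX (by rw [map_one, wordLength_one])
    fun g hg h hh => ?_
  rw [map_mul]
  exact wordLength_mul_le (hY (Subgroup.mem_map_of_mem φ hg)) (hY (Subgroup.mem_map_of_mem φ hh))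

theorem exists_wordLength_map_prod_le (φ : G × H →* K) {X : Set G} (hX : X.Finite) {Z : Set H}
    (hZ : Z.Finite) {Y : Set K}
    (hY : ((Subgroup.closure X).prod (Subgroup.closure Z)).map φ ≤ Subgroup.closure Y) :
    ∃ C, ∀ g ∈ Subgroup.closure X, ∀ h ∈ Subgroup.closure Z,
      wordLength Y (φ (g, h)) ≤ C * (wordLength X g + wordLength Z h) := by
  have map_mem : ∀ g ∈ Subgroup.closure X, ∀ h ∈ Subgroup.closure Z,
      φ (g, h) ∈ Subgroup.closure Y := fun g hg h hh =>
    hY (Subgroup.mem_map_of_mem φ (Subgroup.mem_prod.2 ⟨hg, hh⟩))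
  obtain ⟨C, hC⟩ := exists_wordLength_map_le (φ.comp (MonoidHom.inl G H)) hX (Y := Y) <|
    Subgroup.map_le_iff_le_comap.2 fun g hg => map_mem g hg 1 (one_mem _)
  obtain ⟨D, hD⟩ := exists_wordLength_map_le (φ.comp (MonoidHom.inr G H)) hZ (Y := Y) <|
    Subgroup.map_le_iff_le_comap.2 fun h hh => map_mem 1 (one_mem _) h hh
  refine ⟨max C D, fun g hg h hh => ?_⟩
  calc wordLength Y (φ (g, h))
      = wordLength Y (φ (g, 1) * φ (1, h)) := by rw [← map_mul, Prod.mk_mul_mk, mul_one, one_mul]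
    _ ≤ wordLength Y (φ (g, 1)) + wordLength Y (φ (1, h)) :=
      wordLength_mul_le (map_mem g hg 1 (one_mem _)) (map_mem 1 (one_mem _) h hh)
    _ ≤ C * wordLength X g + D * wordLength Z h := add_le_add (hC g hg) (hD h hh)
    _ ≤ max C D * (wordLength X g + wordLength Z h) := by
      rw [mul_add]
      gcongr
      exacts [le_max_left C D, le_max_right C D]

end WordLength

section RadixSort

variable {α : Type*}

/-- Radix sort of `L` by the `k` lowest binary digits of `key`: one stable partition per digit,
starting with the lowest one. -/
def radixSort (key : α → ℕ) (L : List α) : ℕ → List α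
  | 0 => L
  | k + 1 => (radixSort key L k).filter (fun x => !(key x).testBit k) ++
      (radixSort key L k).filter (fun x => (key x).testBit k)

theorem radixSort_perm (key : α → ℕ) (L : List α) : ∀ k, (radixSort key L k).Perm L
  | 0 => .refl L
  | k + 1 => by
    have h := List.filter_append_perm (fun x => !(key x).testBit k) (radixSort key L k)
    simp only [Bool.not_not] at h
    exact h.trans (radixSort_perm key L k)

theorem radixSort_pairwise (key : α → ℕ) (L : List α) (k : ℕ) :
    (radixSort key L k).Pairwise fun x y => key x % 2 ^ k ≤ key y % 2 ^ k := by
  induction k with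
  | zero => simp [Nat.mod_one, List.pairwise_iff_forall_sublist]
  | succ k ih =>
    have mod_succ : ∀ x, key x % 2 ^ (k + 1) = key x % 2 ^ k + 2 ^ k * ((key x).testBit k).toNat :=
      fun x => by rw [Nat.mod_pow_succ, Nat.toNat_testBit]
    simp only [mod_succ]
    refine List.pairwise_append.2 ⟨?_, ?_, fun x hx y hy => ?_⟩
    · refine List.pairwise_filter.2 (ih.imp fun h hx hy => ?_)
      simp_all
    · refine List.pairwise_filter.2 (ih.imp fun h hx hy => ?_)
      simp_all
    · have hx : (key x).testBit k = false := by simpa using (List.mem_filter.1 hx).2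
      have hy : (key y).testBit k = true := (List.mem_filter.1 hy).2
      rw [hx, hy, Bool.toNat_false, Bool.toNat_true, mul_zero, add_zero, mul_one]
      exact (Nat.mod_lt _ (Nat.two_pow_pos k)).le.trans (Nat.le_add_left _ _)

theorem radixSort_eq_radixSort {key : α → ℕ} {L M : List α} {k : ℕ} (hLM : L.Perm M)
    (hinj : {x | x ∈ L}.InjOn key) (hlt : ∀ x ∈ L, key x < 2 ^ k) :
    radixSort key L k = radixSort key M k := by
  have hL := radixSort_perm key L k
  have hM := radixSort_perm key M k
  refine List.Perm.eq_of_pairwise (fun x y hx hy hxy hyx => ?_) (radixSort_pairwise key L k)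
    (radixSort_pairwise key M k) (hL.trans (hLM.trans hM.symm))
  have hx : x ∈ L := hL.mem_iff.1 hx
  have hy : y ∈ L := hLM.mem_iff.2 (hM.mem_iff.1 hy)
  have hkey := le_antisymm hxy hyx
  rw [Nat.mod_eq_of_lt (hlt x hx), Nat.mod_eq_of_lt (hlt y hy)] at hkey
  exact hinj hx hy hkey

end RadixSort

section Cones

/-- The cones of all infinite words beginning with `u`, respectively with `v`, are disjoint;
equivalently, neither of `u` and `v` is a prefix of the other one. -/
def DisjointCones (u v : List Bool) : Prop :=
  ∀ x y : Stream' Bool, u ++ₛ x ≠ v ++ₛ y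

/-- The cones of the words in `L` partition the set of infinite words, that is, `L` lists a finite
maximal prefix code without repetitions. -/
structure IsConePartition (L : List (List Bool)) : Prop where
  pairwise : L.Pairwise DisjointCones
  exists_mem : ∀ x : Stream' Bool, ∃ u ∈ L, ∃ y, x = u ++ₛ y

theorem eq_singleton_nil_of_pairwise_disjointCones {L : List (List Bool)}
    (hL : L.Pairwise DisjointCones) (hnil : [] ∈ L) : L = [[]] := by
  obtain ⟨L₁, L₂, rfl⟩ := List.append_of_mem hnil
  rw [List.pairwise_append, List.pairwise_cons] at hL
  obtain ⟨-, ⟨hL₂, -⟩, hL₁⟩ := hL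
  have hL₁ : L₁ = [] := List.eq_nil_iff_forall_not_mem.2 fun u hu =>
    hL₁ u hu [] (by simp) (.const true) (u ++ₛ .const true) rfl
  have hL₂ : L₂ = [] := List.eq_nil_iff_forall_not_mem.2 fun u hu =>
    hL₂ u hu (u ++ₛ .const true) (.const true) rfl
  rw [hL₁, hL₂, List.nil_append]

/-- The words `w` such that `b w` is in `L`: the part of the code `L` below the letter `b`. -/
def branch (b : Bool) (L : List (List Bool)) : List (List Bool) :=
  L.filterMap [b].isPrefixOf?

theorem mem_branch {b : Bool} {L : List (List Bool)} {w : List Bool} :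
    w ∈ branch b L ↔ b :: w ∈ L := by
  simp [branch, List.mem_filterMap]

theorem perm_map_cons_branch : ∀ {L : List (List Bool)}, [] ∉ L →
    L.Perm ((branch false L).map (List.cons false) ++ (branch true L).map (List.cons true))
  | [], _ => by simp [branch]
  | [] :: L, h => by simp at h
  | (false :: w) :: L, h => by
    simpa [branch, List.isPrefixOf?] using perm_map_cons_branch (List.not_mem_of_not_mem_cons h)
  | (true :: w) :: L, h => by
    have ih := (perm_map_cons_branch (List.not_mem_of_not_mem_cons h)).cons (true :: w)
    simpa [branch, List.isPrefixOf?] using ih.trans List.perm_middle.symm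

theorem pairwise_disjointCones_branch {L : List (List Bool)} (hL : L.Pairwise DisjointCones)
    (b : Bool) : (branch b L).Pairwise DisjointCones := by
  rw [branch, List.pairwise_filterMap]
  refine hL.imp fun h u hu v hv x y huv => ?_
  rw [List.isPrefixOf?_eq_some_iff_append_eq] at hu hv
  subst hu hv
  exact h x y (congrArg (Stream'.cons b) huv)

theorem IsConePartition.branch {L : List (List Bool)} (hL : IsConePartition L) (hnil : [] ∉ L)
    (b : Bool) : IsConePartition (branch b L) := by
  refine ⟨pairwise_disjointCones_branch hL.pairwise b, fun x => ?_⟩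
  obtain ⟨u, hu, y, hy⟩ := hL.exists_mem (Stream'.cons b x)
  match u, hu with
  | [], hu => exact absurd hu hnil
  | c :: u, hu =>
    obtain ⟨rfl, hxy⟩ := Stream'.cons_injective2 (hy : _ = Stream'.cons c (u ++ₛ y))
    exact ⟨u, mem_branch.2 hu, y, hxy⟩

end Cones

theorem stream_forall_cons {P : Stream' Bool → Prop} (h : ∀ b y, P (Stream'.cons b y))
    (y : Stream' Bool) : P y := by
  rw [← Stream'.eta y]
  exact h _ _

/-- A finite binary tree whose leaves carry finite words. The leaf reached from the root by
descending left at each letter `a = false` and right at each letter `b = true` of the word `p`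
stands for the entry `p ↦ label` of a table. -/
inductive WordTree
  | leaf (p : List Bool) : WordTree
  | node (l r : WordTree) : WordTree

namespace WordTree

/-- The map of infinite words given by the table: it replaces the address of a leaf by the label of
that leaf. -/
def eval : WordTree → Stream' Bool → Stream' Bool
  | leaf p, y => p ++ₛ y
  | node l r, y => bif y.head then r.eval y.tail else l.eval y.tail

/-- The number of inner nodes. Unlike the number of leaves, it is subadditive under composition of
tables and vanishes for the table of the identity. -/
def size : WordTree → ℕ
  | leaf _ => 0
  | node l r => l.size + r.size + 1

/-- The labels of the leaves, from left to right. -/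
def leaves : WordTree → List (List Bool)
  | leaf p => [p]
  | node l r => l.leaves ++ r.leaves

/-- The table of the map `y ↦ t.eval (v y)`. -/
def restrict : WordTree → List Bool → WordTree
  | leaf p, v => leaf (p ++ v)
  | node l r, [] => node l r
  | node l r, b :: v => bif b then r.restrict v else l.restrict v

/-- The table of the composition `t.eval ∘ s.eval`. -/
def comp (t : WordTree) : WordTree → WordTree
  | leaf v => t.restrict v
  | node l r => node (t.comp l) (t.comp r)

@[simp] theorem eval_leaf (p : List Bool) (y : Stream' Bool) : (leaf p).eval y = p ++ₛ y := rfl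

@[simp] theorem eval_node_cons (l r : WordTree) (b : Bool) (y : Stream' Bool) :
    (node l r).eval (Stream'.cons b y) = bif b then r.eval y else l.eval y := rfl

theorem length_leaves : ∀ t : WordTree, t.leaves.length = t.size + 1
  | leaf _ => rfl
  | node l r => by
    rw [leaves, List.length_append, length_leaves l, length_leaves r, size]
    omega

theorem eval_restrict (t : WordTree) (v : List Bool) (y : Stream' Bool) :
    (t.restrict v).eval y = t.eval (v ++ₛ y) := by
  induction t generalizing v with
  | leaf p => rw [restrict, eval_leaf, eval_leaf, Stream'.append_append_stream]
  | node l r ihl ihr =>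
    match v with
    | [] => rfl
    | false :: v => exact ihl v
    | true :: v => exact ihr v

theorem eval_comp (t s : WordTree) : (t.comp s).eval = t.eval ∘ s.eval := by
  induction s with
  | leaf p => exact funext (t.eval_restrict p)
  | node l r ihl ihr =>
    refine funext <| stream_forall_cons fun b y => ?_
    rw [comp, eval_node_cons, ihl, ihr]
    cases b <;> rfl

theorem leaves_leaf_comp (u : List Bool) : ∀ t : WordTree,
    ((leaf u).comp t).leaves = t.leaves.map (u ++ ·)
  | leaf _ => rfl
  | node l r => by
    rw [comp, leaves, leaves_leaf_comp u l, leaves_leaf_comp u r, leaves, List.map_append]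

theorem size_comp (t s : WordTree) :
    (t.comp s).size = s.size + (s.leaves.map fun v => (t.restrict v).size).sum := by
  induction s with
  | leaf p => simp [comp, size, leaves]
  | node l r ihl ihr =>
    simp only [comp, size, ihl, ihr, leaves, List.map_append, List.sum_append]
    omega

theorem sum_size_restrict_le (t : WordTree) {L : List (List Bool)}
    (hL : L.Pairwise DisjointCones) : (L.map fun v => (t.restrict v).size).sum ≤ t.size := by
  induction t generalizing L with
  | leaf p => simp [restrict, size]
  | node l r ihl ihr =>
    by_cases hnil : [] ∈ L
    · rw [eq_singleton_nil_of_pairwise_disjointCones hL hnil]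
      simp [restrict]
    · have hl := ihl (pairwise_disjointCones_branch hL false)
      have hr := ihr (pairwise_disjointCones_branch hL true)
      rw [((perm_map_cons_branch hnil).map _).sum_eq, List.map_append, List.sum_append,
        List.map_map, List.map_map, size]
      exact (add_le_add hl hr).trans (Nat.le_succ _)

theorem exists_eval_append_eq_of_mem_leaves {t : WordTree} {p : List Bool} (hp : p ∈ t.leaves) :
    ∃ u : List Bool, ∀ y, t.eval (u ++ₛ y) = p ++ₛ y := by
  induction t with
  | leaf q =>
    obtain rfl : p = q := List.mem_singleton.1 hp
    exact ⟨[], fun y => rfl⟩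
  | node l r ihl ihr =>
    rcases List.mem_append.1 hp with hp | hp
    · obtain ⟨u, hu⟩ := ihl hp
      exact ⟨false :: u, hu⟩
    · obtain ⟨u, hu⟩ := ihr hp
      exact ⟨true :: u, hu⟩

theorem exists_mem_leaves_eval_eq (t : WordTree) (y : Stream' Bool) :
    ∃ p ∈ t.leaves, ∃ z, t.eval y = p ++ₛ z := by
  induction t generalizing y with
  | leaf p => exact ⟨p, List.mem_singleton_self p, y, rfl⟩
  | node l r ihl ihr =>
    rw [← Stream'.eta y, eval_node_cons]
    cases y.head
    · obtain ⟨p, hp, hz⟩ := ihl y.tail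
      exact ⟨p, List.mem_append_left _ hp, hz⟩
    · obtain ⟨p, hp, hz⟩ := ihr y.tail
      exact ⟨p, List.mem_append_right _ hp, hz⟩

theorem pairwise_disjointCones_leaves {t : WordTree} (ht : Function.Injective t.eval) :
    t.leaves.Pairwise DisjointCones := by
  induction t with
  | leaf p => exact List.pairwise_singleton _ _
  | node l r ihl ihr =>
    refine List.pairwise_append.2
      ⟨ihl (ht.comp (Stream'.cons_injective_right false)),
        ihr (ht.comp (Stream'.cons_injective_right true)), fun p hp q hq x y hxy => ?_⟩
    obtain ⟨u, hu⟩ := exists_eval_append_eq_of_mem_leaves hp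
    obtain ⟨v, hv⟩ := exists_eval_append_eq_of_mem_leaves hq
    rw [← hu, ← hv] at hxy
    have heq : Stream'.cons false (u ++ₛ x) = Stream'.cons true (v ++ₛ y) := ht hxy
    exact Bool.false_ne_true (Stream'.cons_injective2 heq).1

theorem isConePartition_leaves {t : WordTree} (ht : Function.Bijective t.eval) :
    IsConePartition t.leaves where
  pairwise := pairwise_disjointCones_leaves ht.injective
  exists_mem x := by
    obtain ⟨y, rfl⟩ := ht.surjective x
    exact t.exists_mem_leaves_eval_eq y

theorem size_comp_le (t : WordTree) {s : WordTree} (hs : Function.Injective s.eval) :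
    (t.comp s).size ≤ s.size + t.size := by
  rw [size_comp]
  exact Nat.add_le_add_left (t.sum_size_restrict_le (pairwise_disjointCones_leaves hs)) _

theorem exists_eval_eq_id_of_length_le (d : ℕ) {L : List (List Bool)} (hL : IsConePartition L)
    (hd : ∀ u ∈ L, u.length ≤ d) : ∃ t : WordTree, t.eval = id ∧ t.leaves.Perm L := by
  have of_nil_mem : ∀ {L : List (List Bool)}, IsConePartition L → [] ∈ L →
      ∃ t : WordTree, t.eval = id ∧ t.leaves.Perm L := fun hL hnil => by
    rw [eq_singleton_nil_of_pairwise_disjointCones hL.pairwise hnil]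
    exact ⟨leaf [], rfl, .refl _⟩
  induction d generalizing L with
  | zero =>
    obtain ⟨u, hu, -⟩ := hL.exists_mem (.const true)
    obtain rfl : u = [] := List.length_eq_zero_iff.1 (Nat.le_zero.1 (hd u hu))
    exact of_nil_mem hL hu
  | succ d ih =>
    by_cases hnil : [] ∈ L
    · exact of_nil_mem hL hnil
    have hbranch : ∀ b, ∃ t : WordTree, t.eval = id ∧ t.leaves.Perm (branch b L) := fun b =>
      ih (hL.branch hnil b) fun u hu => Nat.le_of_succ_le_succ (hd (b :: u) (mem_branch.1 hu))
    obtain ⟨l, hl, hlL⟩ := hbranch false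
    obtain ⟨r, hr, hrL⟩ := hbranch true
    refine ⟨node ((leaf [false]).comp l) ((leaf [true]).comp r),
      funext <| stream_forall_cons fun b y => ?_, ?_⟩
    · rw [eval_node_cons, eval_comp, eval_comp, hl, hr]
      cases b <;> rfl
    · rw [leaves, leaves_leaf_comp, leaves_leaf_comp]
      exact ((hlL.map _).append (hrL.map _)).trans (perm_map_cons_branch hnil).symm

theorem exists_eval_eq_id_leaves_perm {L : List (List Bool)} (hL : IsConePartition L) :
    ∃ t : WordTree, t.eval = id ∧ t.leaves.Perm L := by
  obtain ⟨d, hd⟩ := (L.finite_toSet.image List.length).bddAbove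
  exact exists_eval_eq_id_of_length_le d hL fun u hu => hd (Set.mem_image_of_mem _ hu)

theorem exists_eval_append_eq (t : WordTree) :
    ∃ N : ℕ, ∀ w : List Bool, N ≤ w.length → ∃ v : List Bool, ∀ y, t.eval (w ++ₛ y) = v ++ₛ y := by
  induction t with
  | leaf p => exact ⟨0, fun w _ => ⟨p ++ w, fun y => (Stream'.append_append_stream p w y).symm⟩⟩
  | node l r ihl ihr =>
    obtain ⟨N, hN⟩ := ihl
    obtain ⟨M, hM⟩ := ihr
    refine ⟨max N M + 1, fun w hw => ?_⟩
    match w, hw with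
    | false :: w, hw => exact hN w ((le_max_left N M).trans (Nat.le_of_succ_le_succ hw))
    | true :: w, hw => exact hM w ((le_max_right N M).trans (Nat.le_of_succ_le_succ hw))

theorem exists_eval_eq_of_forall_length_eq (N : ℕ) {f : Stream' Bool → Stream' Bool}
    (hf : ∀ w : List Bool, w.length = N → ∃ v : List Bool, ∀ y, f (w ++ₛ y) = v ++ₛ y) :
    ∃ t : WordTree, t.eval = f := by
  induction N generalizing f with
  | zero =>
    obtain ⟨v, hv⟩ := hf [] rfl
    exact ⟨leaf v, funext fun y => (hv y).symm⟩
  | succ N ih =>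
    have hcone : ∀ b, ∃ t : WordTree, t.eval = f ∘ Stream'.cons b := fun b =>
      ih fun w hw => hf (b :: w) (congrArg Nat.succ hw)
    obtain ⟨l, hl⟩ := hcone false
    obtain ⟨r, hr⟩ := hcone true
    refine ⟨node l r, funext <| stream_forall_cons fun b y => ?_⟩
    rw [eval_node_cons, hl, hr]
    cases b <;> rfl

end WordTree

theorem mem_thompsonV_iff_exists_eval_eq {g : Equiv.Perm (Stream' Bool)} :
    g ∈ thompsonV ↔ ∃ t : WordTree, t.eval = g := by
  refine (hasFiniteTable_iff g).trans ⟨fun ⟨N, hN⟩ => ?_, fun ⟨t, ht⟩ => ?_⟩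
  · exact WordTree.exists_eval_eq_of_forall_length_eq N fun w hw => hN w hw.ge
  · rw [← ht]
    exact t.exists_eval_append_eq

section TableSize

/-- The complexity `‖g‖` of an element `g` of `V`: the minimal number of inner nodes of a tree that
is a table of `g`. The number of entries of the table is larger by one. -/
noncomputable def tableSize (g : thompsonV) : ℕ :=
  sInf {n : ℕ | ∃ t : WordTree, t.eval = g.1 ∧ t.size = n}

theorem exists_size_eq_tableSize (g : thompsonV) :
    ∃ t : WordTree, t.eval = g.1 ∧ t.size = tableSize g := by
  obtain ⟨t, ht⟩ := mem_thompsonV_iff_exists_eval_eq.1 g.2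
  exact Nat.sInf_mem (s := {n | ∃ t : WordTree, t.eval = g.1 ∧ t.size = n}) ⟨t.size, t, ht, rfl⟩

theorem tableSize_le_size {g : thompsonV} {t : WordTree} (ht : t.eval = g.1) :
    tableSize g ≤ t.size :=
  Nat.sInf_le ⟨t, ht, rfl⟩

theorem tableSize_one : tableSize 1 = 0 :=
  Nat.le_zero.1 (tableSize_le_size (t := .leaf []) rfl)

theorem tableSize_mul_le (g h : thompsonV) : tableSize (g * h) ≤ tableSize g + tableSize h := by
  obtain ⟨t, ht, htg⟩ := exists_size_eq_tableSize g
  obtain ⟨s, hs, hsh⟩ := exists_size_eq_tableSize h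
  rw [← htg, ← hsh, add_comm]
  refine (tableSize_le_size ?_).trans (t.size_comp_le (hs ▸ h.1.injective))
  rw [WordTree.eval_comp, ht, hs]
  rfl

theorem exists_tableSize_le_mul_wordLength {B : Set thompsonV} (hB : B.Finite) :
    ∃ C, ∀ g ∈ Subgroup.closure B, tableSize g ≤ C * wordLength B g :=
  exists_le_mul_wordLength_of_subadditive hB tableSize_one fun g _ h _ => tableSize_mul_le g h

end TableSize

section ConePair

/-- The permutation acting as `g` on the infinite words beginning with `a` and as `h` on those
beginning with `b`. -/
def conePerm (g h : Equiv.Perm (Stream' Bool)) : Equiv.Perm (Stream' Bool) where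
  toFun y := Stream'.cons y.head ((bif y.head then h else g) y.tail)
  invFun y := Stream'.cons y.head ((bif y.head then h else g).symm y.tail)
  left_inv := stream_forall_cons fun b y => by simp
  right_inv := stream_forall_cons fun b y => by simp

theorem conePerm_mem_thompsonV {g h : Equiv.Perm (Stream' Bool)} (hg : g ∈ thompsonV)
    (hh : h ∈ thompsonV) : conePerm g h ∈ thompsonV := by
  obtain ⟨t, ht⟩ := mem_thompsonV_iff_exists_eval_eq.1 hg
  obtain ⟨s, hs⟩ := mem_thompsonV_iff_exists_eval_eq.1 hh
  refine mem_thompsonV_iff_exists_eval_eq.2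
    ⟨.node (.comp (.leaf [false]) t) (.comp (.leaf [true]) s),
      funext <| stream_forall_cons fun b y => ?_⟩
  rw [WordTree.eval_node_cons, WordTree.eval_comp, WordTree.eval_comp, ht, hs]
  cases b <;> rfl

/-- The embedding of `V × V` into `V` by the actions on the two cones of words beginning with `a`
and with `b`. -/
def conePair : thompsonV × thompsonV →* thompsonV where
  toFun g := ⟨conePerm g.1 g.2, conePerm_mem_thompsonV g.1.2 g.2.2⟩
  map_one' := Subtype.ext <| Equiv.ext <| stream_forall_cons fun b y => by cases b <;> rfl
  map_mul' g h := Subtype.ext <| Equiv.ext <| stream_forall_cons fun b y => by cases b <;> rfl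

theorem conePair_apply_cons (g : thompsonV × thompsonV) (b : Bool) (y : Stream' Bool) :
    (conePair g).1 (Stream'.cons b y) = Stream'.cons b ((bif b then g.2 else g.1).1 y) := by
  cases b <;> rfl

theorem conePair_injective : Function.Injective conePair := by
  intro g h hgh
  have apply_eq : ∀ b y, (bif b then g.2 else g.1).1 y = (bif b then h.2 else h.1).1 y :=
    fun b y => Stream'.cons_injective_right b <| by
      rw [← conePair_apply_cons, ← conePair_apply_cons, hgh]
  exact Prod.ext (Subtype.ext <| Equiv.ext (apply_eq false))
    (Subtype.ext <| Equiv.ext (apply_eq true))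

theorem tableSize_component_le (g : thompsonV × thompsonV) (b : Bool) :
    tableSize (bif b then g.2 else g.1) ≤ tableSize (conePair g) + 1 := by
  obtain ⟨t, ht, hsize⟩ := exists_size_eq_tableSize (conePair g)
  let coneTree := t.comp (.leaf [b])
  let tailTree := WordTree.node (.leaf []) (.leaf [])
  have coneTree_eval : coneTree.eval = (conePair g).1 ∘ Stream'.cons b := by
    rw [WordTree.eval_comp, ht]
    rfl
  have coneTree_injective : Function.Injective coneTree.eval := by
    rw [coneTree_eval]
    exact (conePair g).1.injective.comp (Stream'.cons_injective_right b)
  have eval_eq : (tailTree.comp coneTree).eval = (bif b then g.2 else g.1).1 := by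
    funext y
    rw [WordTree.eval_comp, coneTree_eval, Function.comp_apply, Function.comp_apply,
      conePair_apply_cons, WordTree.eval_node_cons, Bool.cond_self]
    rfl
  calc tableSize (bif b then g.2 else g.1)
      ≤ (tailTree.comp coneTree).size := tableSize_le_size eval_eq
    _ ≤ coneTree.size + 1 := tailTree.size_comp_le coneTree_injective
    _ ≤ 0 + t.size + 1 := Nat.add_le_add_right
      (t.size_comp_le (s := .leaf [b]) (Stream'.cons_injective_right b)) 1
    _ = tableSize (conePair g) + 1 := by rw [zero_add, hsize]

end ConePair

section Moves

/-- The element of `V` with table `a ↦ b`, `b ↦ a`. -/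
def coneSwap : thompsonV where
  val :=
    { toFun y := Stream'.cons (!y.head) y.tail
      invFun y := Stream'.cons (!y.head) y.tail
      left_inv := stream_forall_cons fun b y => by cases b <;> rfl
      right_inv := stream_forall_cons fun b y => by cases b <;> rfl }
  property := mem_thompsonV_iff_exists_eval_eq.2
    ⟨.node (.leaf [true]) (.leaf [false]),
      funext <| stream_forall_cons fun b y => by cases b <;> rfl⟩

/-- The element of `V` with table `aa ↦ a`, `ab ↦ ba`, `b ↦ bb`. -/
def coneRotate : thompsonV where
  val :=
    { toFun y := bif y.head then Stream'.cons true y else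
        bif y.tail.head then Stream'.cons true (Stream'.cons false y.tail.tail) else y.tail
      invFun y := bif y.head then
          bif y.tail.head then y.tail else Stream'.cons false (Stream'.cons true y.tail.tail)
        else Stream'.cons false y
      left_inv := stream_forall_cons fun b => stream_forall_cons fun c y => by
        cases b <;> cases c <;> rfl
      right_inv := stream_forall_cons fun b => stream_forall_cons fun c y => by
        cases b <;> cases c <;> rfl }
  property := mem_thompsonV_iff_exists_eval_eq.2
    ⟨.node (.node (.leaf [false]) (.leaf [true, false])) (.leaf [true, true]),
      funext <| stream_forall_cons fun b => stream_forall_cons fun c y => by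
        cases b <;> cases c <;> rfl⟩

/-- The elements of `V` used to sort the leaves of a tree: they swap or rotate the children of the
root, or those of a child of the root. -/
def moves : Set thompsonV :=
  {coneSwap, coneRotate, conePair (coneSwap, 1), conePair (1, coneSwap), conePair (1, coneRotate)}

theorem finite_moves : moves.Finite := by
  simp [moves]

end Moves

namespace WordTree

section Rearrange

variable {s s' : thompsonV} {t t' t'' l l' r r' : WordTree} {m n : ℕ}

/-- `s` rearranges the tree `t` into the tree `t'`: the tables satisfy `t = t' ∘ s`. -/
def Carries (s : thompsonV) (t t' : WordTree) : Prop :=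
  ∀ y, t.eval y = t'.eval (s.1 y)

theorem Carries.refl (t : WordTree) : Carries 1 t t := fun _ => rfl

theorem Carries.symm (h : Carries s t t') : Carries s⁻¹ t' t := fun y => by
  rw [h, ← Equiv.Perm.mul_apply, ← Subgroup.coe_mul, mul_inv_cancel, Subgroup.coe_one,
    Equiv.Perm.one_apply]

theorem Carries.trans (h : Carries s t t') (h' : Carries s' t' t'') :
    Carries (s' * s) t t'' := fun y => by
  rw [h, h', Subgroup.coe_mul, Equiv.Perm.mul_apply]

theorem Carries.node (hl : Carries s l l') (hr : Carries s' r r') :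
    Carries (conePair (s, s')) (node l r) (node l' r') :=
  stream_forall_cons fun b y => by
    rw [conePair_apply_cons, eval_node_cons, eval_node_cons]
    cases b
    · exact hl y
    · exact hr y

theorem carries_coneSwap (l r : WordTree) : Carries coneSwap (.node l r) (.node r l) :=
  stream_forall_cons fun b y => by cases b <;> rfl

theorem carries_coneRotate (A B C : WordTree) :
    Carries coneRotate (.node (.node A B) C) (.node A (.node B C)) :=
  stream_forall_cons fun b => stream_forall_cons fun c y => by cases b <;> cases c <;> rfl

/-- The tree `t` can be rearranged into the tree `t'` by at most `n` moves or inverses of moves. -/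
def RearrangesIn (n : ℕ) (t t' : WordTree) : Prop :=
  ∃ s ∈ Subgroup.closure moves, wordLength moves s ≤ n ∧ Carries s t t'

namespace RearrangesIn

theorem mono (h : RearrangesIn m t t') (hmn : m ≤ n) : RearrangesIn n t t' :=
  let ⟨s, hs, hsm, hst⟩ := h
  ⟨s, hs, hsm.trans hmn, hst⟩

theorem of_eval_eq (h : t.eval = t'.eval) : RearrangesIn 0 t t' :=
  ⟨1, one_mem _, wordLength_one.le, fun y => congrFun h y⟩

theorem symm (h : RearrangesIn n t t') : RearrangesIn n t' t :=
  let ⟨s, hs, hsn, hst⟩ := h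
  ⟨s⁻¹, inv_mem hs, (wordLength_inv_le hs).trans hsn, hst.symm⟩

theorem trans (h : RearrangesIn m t t') (h' : RearrangesIn n t' t'') :
    RearrangesIn (m + n) t t'' := by
  obtain ⟨s, hs, hsm, hst⟩ := h
  obtain ⟨s', hs', hsn, hst'⟩ := h'
  refine ⟨s' * s, mul_mem hs' hs, (wordLength_mul_le hs' hs).trans ?_, hst.trans hst'⟩
  rw [add_comm m]
  exact add_le_add hsn hsm

theorem of_mem_moves (hs : s ∈ moves) (h : Carries s t t') : RearrangesIn 1 t t' :=
  ⟨s, Subgroup.subset_closure hs, wordLength_le_one_of_mem hs, h⟩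

end RearrangesIn

theorem rearrangesIn_swap (l r : WordTree) : RearrangesIn 1 (node l r) (node r l) :=
  .of_mem_moves (by simp [moves]) (carries_coneSwap l r)

theorem rearrangesIn_rotate (A B C : WordTree) :
    RearrangesIn 1 (node (node A B) C) (node A (node B C)) :=
  .of_mem_moves (by simp [moves]) (carries_coneRotate A B C)

theorem rearrangesIn_swap_left (A B C : WordTree) :
    RearrangesIn 1 (node (node A B) C) (node (node B A) C) :=
  .of_mem_moves (by simp [moves]) ((carries_coneSwap A B).node (.refl C))

theorem rearrangesIn_swap_right (A B C : WordTree) :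
    RearrangesIn 1 (node A (node B C)) (node A (node C B)) :=
  .of_mem_moves (by simp [moves]) ((Carries.refl A).node (carries_coneSwap B C))

theorem rearrangesIn_rotate_right (A B C D : WordTree) :
    RearrangesIn 1 (node A (node (node B C) D)) (node A (node B (node C D))) :=
  .of_mem_moves (by simp [moves]) ((Carries.refl A).node (carries_coneRotate B C D))

end Rearrange

section Stacks

/-- A tree viewed as a machine with three registers that hold trees. -/
abbrev registers (A B C : WordTree) : WordTree :=
  node (node A B) C

/-- The stack of the labels in `L`, with the head of `L` on top, on the ground `A`. -/
def stack (A : WordTree) (L : List (List Bool)) : WordTree :=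
  L.foldr (fun x t => node (leaf x) t) A

theorem stack_append (A : WordTree) (L M : List (List Bool)) :
    stack A (L ++ M) = stack (stack A M) L :=
  List.foldr_append

theorem rearrangesIn_push_left (A B C t : WordTree) :
    RearrangesIn 6 (registers A B (node t C)) (registers (node t A) B C) :=
  (rearrangesIn_swap (node A B) (node t C)).trans <|
    (rearrangesIn_rotate t C (node A B)).trans <|
    (rearrangesIn_swap_right t C (node A B)).trans <|
    (rearrangesIn_rotate_right t A B C).trans <|
    (rearrangesIn_rotate t A (node B C)).symm.trans (rearrangesIn_rotate (node t A) B C).symm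

theorem rearrangesIn_push_right (A B C t : WordTree) :
    RearrangesIn 8 (registers A B (node t C)) (registers A (node t B) C) :=
  (rearrangesIn_swap_left A B (node t C)).trans <|
    (rearrangesIn_push_left B A C t).trans (rearrangesIn_swap_left (node t B) A C)

theorem rearrangesIn_flatten (A B t C : WordTree) :
    RearrangesIn (7 * t.size + 6) (registers A B (node t C))
      (registers (stack A t.leaves.reverse) B C) := by
  induction t generalizing A C with
  | leaf p => exact rearrangesIn_push_left A B C (leaf p)
  | node l r ihl ihr =>
    rw [leaves, List.reverse_append, stack_append]
    refine ((rearrangesIn_rotate_right (node A B) l r C).trans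
      ((ihl A (node r C)).trans (ihr _ C))).mono ?_
    rw [size]
    omega

theorem rearrangesIn_unload_left (A B C : WordTree) (L : List (List Bool)) :
    RearrangesIn (6 * L.length) (registers (stack A L) B C)
      (registers A B (stack C L.reverse)) := by
  induction L generalizing C with
  | nil => exact .of_eval_eq rfl
  | cons x L ih =>
    rw [List.reverse_cons, stack_append]
    refine ((rearrangesIn_push_left (stack A L) B C (leaf x)).symm.trans
      (ih (node (leaf x) C))).mono ?_
    rw [List.length_cons]
    omega

theorem rearrangesIn_unload_right (A B C : WordTree) (L : List (List Bool)) :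
    RearrangesIn (8 * L.length) (registers A (stack B L) C)
      (registers A B (stack C L.reverse)) := by
  induction L generalizing C with
  | nil => exact .of_eval_eq rfl
  | cons x L ih =>
    rw [List.reverse_cons, stack_append]
    refine ((rearrangesIn_push_right A (stack B L) C (leaf x)).symm.trans
      (ih (node (leaf x) C))).mono ?_
    rw [List.length_cons]
    omega

theorem rearrangesIn_distribute (p : List Bool → Bool) (A B C : WordTree) (L : List (List Bool)) :
    RearrangesIn (8 * L.length) (registers A B (stack C L))
      (registers (stack A (L.filter (!p ·)).reverse) (stack B (L.filter p).reverse) C) := by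
  induction L generalizing A B with
  | nil => exact .of_eval_eq rfl
  | cons x L ih =>
    rw [List.length_cons, mul_add_one, add_comm]
    cases hx : p x
    · have hpush := (rearrangesIn_push_left A B (stack C L) (leaf x)).mono (show 6 ≤ 8 by norm_num)
      simpa [hx, stack] using hpush.trans (ih (node (leaf x) A) B)
    · have hpush := rearrangesIn_push_right A B (stack C L) (leaf x)
      simpa [hx, stack] using hpush.trans (ih A (node (leaf x) B))

theorem rearrangesIn_partition (p : List Bool → Bool) (A B C : WordTree) (L : List (List Bool)) :
    RearrangesIn (16 * L.length) (registers A B (stack C L))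
      (registers A B (stack C (L.filter (!p ·) ++ L.filter p))) := by
  have hright := rearrangesIn_unload_right (stack A (L.filter (!p ·)).reverse) B C
    (L.filter p).reverse
  have hleft := rearrangesIn_unload_left A B (stack C (L.filter p)) (L.filter (!p ·)).reverse
  rw [List.reverse_reverse] at hright hleft
  rw [stack_append]
  refine ((rearrangesIn_distribute p A B C L).trans (hright.trans hleft)).mono ?_
  have hlength := (List.filter_append_perm p L).length_eq
  rw [List.length_append] at hlength
  rw [List.length_reverse, List.length_reverse]
  omega

theorem rearrangesIn_radixSort (key : List Bool → ℕ) (A B C : WordTree) (L : List (List Bool))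
    (k : ℕ) : RearrangesIn (16 * L.length * k) (registers A B (stack C L))
      (registers A B (stack C (radixSort key L k))) := by
  induction k with
  | zero => exact .of_eval_eq rfl
  | succ k ih =>
    have h := rearrangesIn_partition (fun x => (key x).testBit k) A B C (radixSort key L k)
    rw [(radixSort_perm key L k).length_eq] at h
    exact ih.trans h

theorem rearrangesIn_stack_of_perm (A B C : WordTree) {L M : List (List Bool)} (hLM : L.Perm M) :
    RearrangesIn (32 * L.length * (Nat.log 2 L.length + 1)) (registers A B (stack C L))
      (registers A B (stack C M)) := by
  set k := Nat.log 2 L.length + 1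
  have hL := rearrangesIn_radixSort L.idxOf A B C L k
  have hM := rearrangesIn_radixSort L.idxOf A B C M k
  have hsort : radixSort L.idxOf L k = radixSort L.idxOf M k :=
    radixSort_eq_radixSort hLM (fun x hx y _ => (List.idxOf_inj hx).1) fun x hx =>
      (List.idxOf_lt_length_of_mem hx).trans (Nat.lt_pow_succ_log_self one_lt_two _)
  rw [hsort] at hL
  rw [← hLM.length_eq] at hM
  exact (hL.trans hM.symm).mono (by linarith)

end Stacks

section LeafSort

theorem exists_rearrangesIn_node_leaf_of_mem_left {t : WordTree} (U : WordTree) {v : List Bool}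
    (hv : v ∈ t.leaves) :
    ∃ U' : WordTree, (v :: U'.leaves).Perm (t.leaves ++ U.leaves) ∧
      RearrangesIn (2 * t.size) (node t U) (node (leaf v) U') := by
  induction t generalizing U with
  | leaf p =>
    obtain rfl : v = p := List.mem_singleton.1 hv
    exact ⟨U, .refl _, .of_eval_eq rfl⟩
  | node l r ihl ihr =>
    rcases List.mem_append.1 hv with hv | hv
    · obtain ⟨U', hU', hrearr⟩ := ihl (node r U) hv
      refine ⟨U', by simpa [leaves] using hU', ((rearrangesIn_rotate l r U).trans hrearr).mono ?_⟩
      rw [size]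
      omega
    · obtain ⟨U', hU', hrearr⟩ := ihr (node l U) hv
      refine ⟨U', hU'.trans ?_, ((rearrangesIn_swap_left l r U).trans
        ((rearrangesIn_rotate r l U).trans hrearr)).mono ?_⟩
      · rw [leaves, leaves, ← List.append_assoc]
        exact List.perm_append_comm.append_right _
      · rw [size]
        omega

theorem exists_rearrangesIn_node_leaf {t : WordTree} (ht : t.size ≠ 0) {v : List Bool}
    (hv : v ∈ t.leaves) :
    ∃ U : WordTree, (v :: U.leaves).Perm t.leaves ∧
      RearrangesIn (2 * t.size) t (node (leaf v) U) := by
  match t, ht with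
  | .node l r, _ =>
    rw [size]
    rcases List.mem_append.1 hv with hv | hv
    · obtain ⟨U, hU, hrearr⟩ := exists_rearrangesIn_node_leaf_of_mem_left r hv
      exact ⟨U, hU, hrearr.mono (by omega)⟩
    · obtain ⟨U, hU, hrearr⟩ := exists_rearrangesIn_node_leaf_of_mem_left l hv
      exact ⟨U, hU.trans List.perm_append_comm,
        ((rearrangesIn_swap l r).trans hrearr).mono (by omega)⟩

/-- A tree with leaves labelled `v` and by the words in `L`, the leaf labelled `v` being split in
three so as to provide the three registers; the words in `L` are stacked on the last one. -/
def stackForm (v : List Bool) (L : List (List Bool)) : WordTree :=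
  registers (leaf (v ++ [false, false])) (leaf (v ++ [false, true])) (stack (leaf (v ++ [true])) L)

theorem eval_stackForm_nil (v : List Bool) : (stackForm v []).eval = (leaf v).eval :=
  funext <| stream_forall_cons fun b => stream_forall_cons fun c y => by
    cases b <;> cases c <;> simp [stackForm, stack, Stream'.cons_append_stream]

theorem exists_rearrangesIn_stackForm {t : WordTree} (ht : t.size ≠ 0) {v : List Bool}
    (hv : v ∈ t.leaves) :
    ∃ L : List (List Bool), (v :: L).Perm t.leaves ∧
      RearrangesIn (16 * t.size) t (stackForm v L) := by
  obtain ⟨U, hU, hpromote⟩ := exists_rearrangesIn_node_leaf ht hv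
  have hsize : U.size + 1 = t.size := by
    have := hU.length_eq
    rw [List.length_cons, length_leaves, length_leaves] at this
    omega
  set A := leaf (v ++ [false, false])
  set B := leaf (v ++ [false, true])
  set C := leaf (v ++ [true])
  have hsplit : RearrangesIn 0 (node (leaf v) U) (node (registers A B C) U) :=
    .of_eval_eq <| funext <| stream_forall_cons fun b y => by
      rw [eval_node_cons, eval_node_cons, ← eval_stackForm_nil]
      rfl
  have hload : RearrangesIn 2 (node (registers A B C) U) (registers A B (node U C)) :=
    (rearrangesIn_rotate (node A B) C U).trans (rearrangesIn_swap_right (node A B) C U)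
  have hflatten := rearrangesIn_flatten A B U C
  have hunload := rearrangesIn_unload_left A B C U.leaves.reverse
  rw [List.reverse_reverse, List.length_reverse, length_leaves] at hunload
  exact ⟨U.leaves, hU, (hpromote.trans <| hsplit.trans <| hload.trans <|
    hflatten.trans hunload).mono (by omega)⟩

theorem rearrangesIn_of_leaves_perm {t t' : WordTree} (h : t.leaves.Perm t'.leaves) :
    RearrangesIn (64 * t.size * (Nat.log 2 t.size + 1)) t t' := by
  have hsize : t'.size = t.size := by
    simpa only [length_leaves, Nat.add_right_cancel_iff] using h.symm.length_eq
  by_cases ht : t.size = 0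
  · match t, t', ht, hsize with
    | .leaf p, .leaf q, _, _ =>
      obtain rfl : p = q := by simpa [leaves] using h
      exact .of_eval_eq rfl
  obtain ⟨v, hv⟩ := List.exists_mem_of_length_pos (l := t.leaves) (by rw [length_leaves]; omega)
  obtain ⟨L, hL, htL⟩ := exists_rearrangesIn_stackForm ht hv
  obtain ⟨M, hM, htM⟩ := exists_rearrangesIn_stackForm (hsize ▸ ht) (h.mem_iff.1 hv)
  have hsort := rearrangesIn_stack_of_perm (leaf (v ++ [false, false])) (leaf (v ++ [false, true]))
    (leaf (v ++ [true])) (((hL.trans h).trans hM.symm).cons_inv)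
  have hlength : L.length = t.size := by
    simpa only [List.length_cons, length_leaves, Nat.add_right_cancel_iff] using hL.length_eq
  rw [hlength] at hsort
  rw [hsize] at htM
  refine (htL.trans (hsort.trans htM.symm)).mono ?_
  linarith [Nat.zero_le (t.size * Nat.log 2 t.size)]

end LeafSort

end WordTree

section WordLengthBound

theorem mem_closure_moves_and_wordLength_moves_le (g : thompsonV) :
    g ∈ Subgroup.closure moves ∧
      wordLength moves g ≤ 64 * tableSize g * (Nat.log 2 (tableSize g) + 1) := by
  obtain ⟨t, ht, hsize⟩ := exists_size_eq_tableSize g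
  obtain ⟨t', ht', hperm⟩ := WordTree.exists_eval_eq_id_leaves_perm
    (WordTree.isConePartition_leaves (ht ▸ g.1.bijective))
  obtain ⟨s, hs, hlength, hcarries⟩ := WordTree.rearrangesIn_of_leaves_perm hperm.symm
  obtain rfl : g = s := Subtype.ext <| Equiv.ext fun y => by rw [← ht, hcarries, ht', id]
  rw [← hsize]
  exact ⟨hs, hlength⟩

theorem exists_wordLength_le_mul_tableSize_mul_log {A : Set thompsonV}
    (hA : Subgroup.closure A = ⊤) :
    ∃ c, ∀ g, wordLength A g ≤ c * tableSize g * (Nat.log 2 (tableSize g) + 1) := by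
  obtain ⟨c, hc⟩ := exists_wordLength_map_le (MonoidHom.id thompsonV) finite_moves
    (hA ▸ le_top : _ ≤ Subgroup.closure A)
  refine ⟨c * 64, fun g => ?_⟩
  obtain ⟨hg, hlength⟩ := mem_closure_moves_and_wordLength_moves_le g
  calc wordLength A g
      ≤ c * wordLength moves g := hc g hg
    _ ≤ c * (64 * tableSize g * (Nat.log 2 (tableSize g) + 1)) := Nat.mul_le_mul_left c hlength
    _ = c * 64 * tableSize g * (Nat.log 2 (tableSize g) + 1) := by ring

/-- The function `n ↦ ⌈n log₂ n⌉`; its value at `0` is `0`. -/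
noncomputable def ceilMulLogb (n : ℕ) : ℕ :=
  ⌈(n : ℝ) * Real.logb 2 n⌉₊

theorem monotone_ceilMulLogb : Monotone ceilMulLogb := fun m n hmn => by
  have logb_nonneg : ∀ k : ℕ, 0 ≤ Real.logb 2 k := fun k =>
    div_nonneg (Real.log_natCast_nonneg k) (Real.log_nonneg one_le_two)
  refine Nat.ceil_mono ?_
  rcases Nat.eq_zero_or_pos m with rfl | hm
  · rw [Nat.cast_zero, zero_mul]
    exact mul_nonneg (Nat.cast_nonneg n) (logb_nonneg n)
  · gcongr
    · exact logb_nonneg m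
    · norm_num

theorem mul_log_add_one_le_ceilMulLogb (c m : ℕ) :
    c * m * (Nat.log 2 m + 1) ≤ ceilMulLogb (2 * (c + 1) * m) := by
  rcases Nat.eq_zero_or_pos m with rfl | hm
  · rw [mul_zero, zero_mul]
    exact Nat.zero_le _
  have hm : (0 : ℝ) < m := Nat.cast_pos.2 hm
  have hlog : (Nat.log 2 m : ℝ) + 1 ≤ Real.logb 2 (2 * (c + 1) * m) :=
    calc (Nat.log 2 m : ℝ) + 1
        ≤ Real.logb 2 m + 1 := by
          gcongr
          exact_mod_cast Real.natLog_le_logb m 2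
      _ = Real.logb 2 (2 * m) := by
          rw [Real.logb_mul two_ne_zero hm.ne', Real.logb_self_eq_one one_lt_two, add_comm]
      _ ≤ Real.logb 2 (2 * (c + 1) * m) := by
          gcongr
          · exact one_lt_two
          · linarith [Nat.cast_nonneg (α := ℝ) c]
  refine Nat.cast_le (α := ℝ).1 (le_trans ?_ (Nat.le_ceil _))
  push_cast
  gcongr
  linarith [Nat.cast_nonneg (α := ℝ) c]

theorem exists_wordLength_component_le {A B : Set thompsonV} (hA : Subgroup.closure A = ⊤)
    (hB : B.Finite) (hBgen : Subgroup.closure B = ⊤) :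
    ∃ N > 0, ∀ (g : thompsonV × thompsonV) (b : Bool),
      wordLength A (bif b then g.2 else g.1) ≤ ceilMulLogb (N * wordLength B (conePair g)) := by
  obtain ⟨c, hc⟩ := exists_wordLength_le_mul_tableSize_mul_log hA
  obtain ⟨C, hC⟩ := exists_tableSize_le_mul_wordLength hB
  have mem_closure : ∀ g, g ∈ Subgroup.closure B := fun g => hBgen ▸ Subgroup.mem_top g
  refine ⟨2 * (c + 1) * (C + 1), by positivity, fun g b => ?_⟩
  rcases Nat.eq_zero_or_pos (wordLength B (conePair g)) with hzero | hpos
  · have hg : g = 1 := conePair_injective <| by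
      rw [eq_one_of_wordLength_eq_zero (mem_closure _) hzero, map_one]
    rw [hg, Prod.fst_one, Prod.snd_one, Bool.cond_self, wordLength_one]
    exact Nat.zero_le _
  set n := wordLength B (conePair g)
  set m := tableSize (bif b then g.2 else g.1)
  have hm : m ≤ (C + 1) * n :=
    calc m ≤ tableSize (conePair g) + 1 := tableSize_component_le g b
      _ ≤ C * n + n := add_le_add (hC _ (mem_closure _)) hpos
      _ = (C + 1) * n := (add_one_mul C n).symm
  calc wordLength A (bif b then g.2 else g.1)
      ≤ c * m * (Nat.log 2 m + 1) := hc _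
    _ ≤ ceilMulLogb (2 * (c + 1) * m) := mul_log_add_one_le_ceilMulLogb c m
    _ ≤ ceilMulLogb (2 * (c + 1) * (C + 1) * n) := monotone_ceilMulLogb <| by
      rw [mul_assoc _ (C + 1)]
      exact Nat.mul_le_mul_left _ hm

end WordLengthBound

section Distortion

theorem linearlyEquivalent_mul_comp_mul {F : ℕ → ℕ} (hF : Monotone F) {C N : ℕ} (hC : 0 < C)
    (hN : 0 < N) : LinearlyEquivalent (fun n => C * F (N * n)) F := by
  refine ⟨1, C, N, 1, 1, one_pos, hC, hN, one_pos, one_pos, fun n _ => ⟨le_rfl, ?_⟩⟩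
  rw [one_mul, one_mul]
  exact (hF (Nat.le_mul_of_pos_left n hN)).trans (Nat.le_mul_of_pos_left _ hC)

theorem exists_isDistortionFunction_conePair {A X B Y : Set thompsonV}
    (hA : Subgroup.closure A = ⊤) (hX : X.Finite) (hB : B.Finite) (hBgen : Subgroup.closure B = ⊤)
    (hY : Subgroup.closure Y = ((Subgroup.closure X).prod (Subgroup.closure X)).map conePair)
    {δ : ℕ → ℕ} (hδ : IsDistortionFunction A X δ) :
    ∃ C > 0, ∃ N > 0, IsDistortionFunction B Y fun n => C * δ (ceilMulLogb (N * n)) := by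
  obtain ⟨N, hN, hcomponent⟩ := exists_wordLength_component_le hA hB hBgen
  obtain ⟨C, hC⟩ := exists_wordLength_map_prod_le conePair hX hX hY.ge
  refine ⟨2 * C + 1, Nat.succ_pos _, N, hN, ?_, fun k hk => ?_⟩
  · exact (hδ.1.comp (monotone_ceilMulLogb.comp (monotone_id.const_mul' N))).const_mul' _
  rw [hY] at hk
  obtain ⟨⟨g, h⟩, ⟨hg, hh⟩, rfl⟩ := hk
  set D := δ (ceilMulLogb (N * wordLength B (conePair (g, h))))
  have hgD : wordLength X g ≤ D := (hδ.2 g hg).trans (hδ.1 (hcomponent (g, h) false))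
  have hhD : wordLength X h ≤ D := (hδ.2 h hh).trans (hδ.1 (hcomponent (g, h) true))
  calc wordLength Y (conePair (g, h))
      ≤ C * (wordLength X g + wordLength X h) := hC g hg h hh
    _ ≤ C * (D + D) := Nat.mul_le_mul_left C (add_le_add hgD hhD)
    _ ≤ (2 * C + 1) * D := by linarith [Nat.zero_le D]

end Distortion

theorem mainTheorem10_general {A X : Set thompsonV} (hA : Subgroup.closure A = ⊤) (hX : X.Finite)
    {δ : ℕ → ℕ} (hδ : IsDistortionFunction A X δ) :
    ∃ K : Subgroup thompsonV, Nonempty (K ≃* Subgroup.closure X × Subgroup.closure X) ∧ K.FG ∧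
      ∀ B : Set thompsonV, B.Finite → Subgroup.closure B = ⊤ →
      ∀ Y : Set thompsonV, Subgroup.closure Y = K →
        ∃ f : ℕ → ℕ, IsDistortionFunction B Y f ∧
          LinearlyEquivalent f (fun n => δ ⌈(n : ℝ) * Real.logb 2 (n : ℝ)⌉₊) := by
  set G := Subgroup.closure X
  have hGfg : G.FG := (Subgroup.fg_iff G).2 ⟨X, rfl, hX⟩
  have hfg : ((G.prod G).map conePair).FG := (Subgroup.fg_iff_submonoid_fg _).2 <|
    ((Subgroup.fg_iff_submonoid_fg _).1 (hGfg.prod hGfg)).map conePair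
  refine ⟨(G.prod G).map conePair,
    ⟨((G.prod G).equivMapOfInjective conePair conePair_injective).symm.trans
      (Subgroup.prodEquiv G G)⟩, hfg, fun B hB hBgen Y hY => ?_⟩
  obtain ⟨C, hC, N, hN, hdistortion⟩ :=
    exists_isDistortionFunction_conePair hA hX hB hBgen hY hδ
  exact ⟨_, hdistortion,
    linearlyEquivalent_mul_comp_mul (hδ.1.comp monotone_ceilMulLogb) hC hN⟩

theorem mainTheorem10 (G : Subgroup thompsonV)
    (A : Set thompsonV) (hA : A.Finite) (hAgen : Subgroup.closure A = ⊤)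
    (X : Set thompsonV) (hX : X.Finite) (hXgen : Subgroup.closure X = G)
    (δ : ℕ → ℕ) (hδ : IsDistortionFunction A X δ) :
    ∃ K : Subgroup thompsonV, Nonempty (K ≃* G × G) ∧ K.FG ∧
      ∀ B : Set thompsonV, B.Finite → Subgroup.closure B = ⊤ →
      ∀ Y : Set thompsonV, Y.Finite → Subgroup.closure Y = K →
        ∃ f : ℕ → ℕ, IsDistortionFunction B Y f ∧
          LinearlyEquivalent f (fun n => δ ⌈(n : ℝ) * Real.logb 2 (n : ℝ)⌉₊) := by
  subst hXgen
  obtain ⟨K, hK, hKfg, hdistortion⟩ := mainTheorem10_general hAgen hX hδ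
  exact ⟨K, hK, hKfg, fun B hB hBgen Y _ => hdistortion B hB hBgen Y⟩
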